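/- Let $X$ be a $T_1$-space. A set-valued mapping $\varphi$ from $X$ to the nonempty subsets of a metric space $(E,d)$ is called l.s.c. if $\{x\in X:\varphi(x)\cap U\neq\emptyset\}$ is open in $X$ for every open $U\subset E$. A map $f:X\to E$ is a selection for $\varphi$ if $f(x)\in\varphi(x)$ for all $x\in X$. For a function $\eta:X\to(0,+\infty)$, a map $g:X\to E$ is an $\eta$-selection for $\varphi$ if $d(g(x),\varphi(x))=\inf_{y\in\varphi(x)}d(g(x),y)<\eta(x)$ for all $x\in X$. The function $\eta$ is lower semi-continuous if $\{x\in X:\eta(x)>r\}$ is open for every $r\in\mathbb{R}$. The space $X$ is countably paracompact if every countable open cover of $X$ has a locally finite open refinement. Banach spaces are real and carry the metric $d$ of their norm. Then the following are equivalent: (a) $X$ is countably paracompact and normal. (b) For every separable Banach space $E$, every l.s.c. mapping $\varphi$ from $X$ to the nonempty closed convex subsets of $E$, every lower semi-continuous $\eta:X\to(0,+\infty)$ and every continuous $\eta$-selection $g:X\to E$ for $\varphi$, there is a continuous selection $f:X\to E$ for $\varphi$ such that $d(f(x),g(x))<\eta(x)$ for all $x\in X$. (c) For every l.s.c. mapping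 $\varphi$ from $X$ to the nonempty compact convex subsets of $\mathbb{R}$, every real number $\varepsilon>0$ and every continuous $\varepsilon$-selection $g:X\to\mathbb{R}$ for $\varphi$ (that is, an $\eta$-selection for the constant function $\eta=\varepsilon$), there is a continuous selection $f:X\to\mathbb{R}$ for $\varphi$ such that $|f(x)-g(x)|<\varepsilon$ for all $x\in X$. -/

import Mathlib

universe u v

/-- A topological space is countably paracompact if every countable open cover has a
locally finite open refinement. -/
class CountablyParacompactSpace (X : Type u) [TopologicalSpace X] : Prop where
  locallyFinite_refinement :
    ∀ s : ℕ → Set X, (∀ n, IsOpen (s n)) → (⋃ n, s n) = Set.univ →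
      ∃ (β : Type u) (t : β → Set X),
        (∀ b, IsOpen (t b)) ∧ (⋃ b, t b) = Set.univ ∧ LocallyFinite t ∧ ∀ b, ∃ n, t b ⊆ s n

/-- `f` is a selection for the set-valued mapping `φ`. -/
def IsSelection {X E : Type*} (φ : X → Set E) (f : X → E) : Prop :=
  ∀ x, f x ∈ φ x

/-- `g` is an `η`-selection for the set-valued mapping `φ` (with nonempty values):
the distance from `g x` to the set `φ x` is less than `η x`, for every `x`. -/
def IsApproxSelection {X E : Type*} [PseudoMetricSpace E]
    (φ : X → Set E) (η : X → ℝ) (g : X → E) : Prop :=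
  ∀ x, Metric.infDist (g x) (φ x) < η x

/-! For (a) to (b), the distance from `g` to `φ` is upper semicontinuous and lies below `η`, so a
continuous `α` fits strictly between them. Then `φ x ∩ ball (g x) (α x)` is lower hemicontinuous
with nonempty convex values, and Michael's iteration selects from its closure. That closure lies in
`φ x` and in the closed ball of radius `α x < η x`, so the strict bound survives. Separability of
`E` makes countable covers suffice. For (c) to (a), interval-valued mappings encode the topology:
normality by separating 0 from 1, countable paracompactness by using the strict bound to keep a
selection away from 0. -/

open Set Filter Topology in
/-- In a countably paracompact normal space, constants that lie locally in a family of convex sets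
can be glued over a countable open cover. -/
theorem exists_continuous_forall_mem_convex_of_countable_cover
    {X : Type u} [TopologicalSpace X] [NormalSpace X] (hX : CountablyParacompactSpace X)
    {E : Type v} [NormedAddCommGroup E] [NormedSpace ℝ E]
    (U : ℕ → Set X) (c : ℕ → E) (t : X → Set E) (hU : ∀ n, IsOpen (U n))
    (hcov : ∀ x, ∃ n, x ∈ U n) (ht : ∀ x, Convex ℝ (t x)) (hc : ∀ n, ∀ x ∈ U n, c n ∈ t x) :
    ∃ f : X → E, Continuous f ∧ ∀ x, f x ∈ t x := by
  obtain ⟨β, V, hV, hVcov, hVlf, hVU⟩ :=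
    hX.locallyFinite_refinement U hU (iUnion_eq_univ_iff.2 hcov)
  choose n hn using hVU
  obtain ⟨ρ, hρ⟩ := PartitionOfUnity.exists_isSubordinate_of_locallyFinite isClosed_univ V hV hVlf
    hVcov.ge
  refine ⟨fun x => ∑ᶠ b, ρ b x • c (n b),
    ρ.continuous_finsum_smul fun _ _ _ => continuousAt_const, fun x => ?_⟩
  refine ρ.finsum_smul_mem_convex (g := fun b _ => c (n b)) (mem_univ x) (fun b hb => ?_) (ht x)
  exact hc _ _ (hn b (hρ b (subset_closure hb)))

open Set Filter Topology in
/-- Insertion of a continuous function between an upper and a lower semicontinuous one. -/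
theorem exists_continuous_between_of_semicontinuous
    {X : Type u} [TopologicalSpace X] [NormalSpace X] (hX : CountablyParacompactSpace X)
    {h η : X → ℝ} (hh : UpperSemicontinuous h) (hη : LowerSemicontinuous η)
    (hlt : ∀ x, h x < η x) :
    ∃ α : X → ℝ, Continuous α ∧ ∀ x, h x < α x ∧ α x < η x := by
  obtain ⟨q, hq⟩ := TopologicalSpace.exists_dense_seq ℝ
  refine exists_continuous_forall_mem_convex_of_countable_cover hX
    (fun n => {x | h x < q n} ∩ {x | q n < η x}) q (fun x => Ioo (h x) (η x))
    (fun n => (hh.isOpen_preimage (q n)).inter (hη.isOpen_preimage (q n))) (fun x => ?_)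
    (fun x => convex_Ioo _ _) (fun n x hx => hx)
  obtain ⟨n, hn⟩ := hq.exists_mem_open isOpen_Ioo (nonempty_Ioo.2 (hlt x))
  exact ⟨n, hn⟩

/-- The intersection of a lower hemicontinuous mapping with balls of continuously varying centres
and radii is lower hemicontinuous. -/
theorem LowerHemicontinuous.inter_ball {X E : Type*} [TopologicalSpace X] [PseudoMetricSpace E]
    {φ : X → Set E} (hφ : LowerHemicontinuous φ) {g : X → E} (hg : Continuous g)
    {r : X → ℝ} (hr : Continuous r) :
    LowerHemicontinuous fun x => φ x ∩ Metric.ball (g x) (r x) := by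
  refine hφ.inter_hasOpenCGraph ?_
  exact isOpen_lt (continuous_snd.dist (hg.comp continuous_fst)) (hr.comp continuous_fst)

/-- Lower hemicontinuity makes the distance to the values upper semicontinuous. -/
theorem LowerHemicontinuous.upperSemicontinuous_infDist {X E : Type*} [TopologicalSpace X]
    [PseudoMetricSpace E] {φ : X → Set E} (hφ : LowerHemicontinuous φ)
    (hne : ∀ x, (φ x).Nonempty) {g : X → E} (hg : Continuous g) :
    UpperSemicontinuous fun x => Metric.infDist (g x) (φ x) := by
  refine upperSemicontinuous_iff_isOpen_preimage.2 fun r => ?_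
  have := lowerHemicontinuous_iff_isOpen_inter_nonempty.1
    (hφ.inter_ball hg (continuous_const (y := r))) Set.univ isOpen_univ
  convert this using 1
  ext x
  simp only [Set.mem_preimage, Set.mem_Iio, Metric.infDist_lt_iff (hne x), Set.inter_univ,
    Set.mem_ofPred_eq, Set.Nonempty, Set.mem_inter_iff, Metric.mem_ball, dist_comm]

open Set Filter Topology in
/-- Approximate selections for lower hemicontinuous convex-valued mappings. -/
theorem LowerHemicontinuous.exists_continuous_inter_ball_nonempty
    {X : Type u} [TopologicalSpace X] [NormalSpace X] (hX : CountablyParacompactSpace X)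
    {E : Type v} [NormedAddCommGroup E] [NormedSpace ℝ E] [TopologicalSpace.SeparableSpace E]
    {φ : X → Set E} (hφ : LowerHemicontinuous φ) (hne : ∀ x, (φ x).Nonempty)
    (hconv : ∀ x, Convex ℝ (φ x)) {s : ℝ} (hs : 0 < s) :
    ∃ f : X → E, Continuous f ∧ ∀ x, (φ x ∩ Metric.ball (f x) s).Nonempty := by
  obtain ⟨q, hq⟩ := TopologicalSpace.exists_dense_seq E
  obtain ⟨f, hf, hft⟩ := exists_continuous_forall_mem_convex_of_countable_cover hX
    (fun n => {x | (φ x ∩ Metric.ball (q n) s).Nonempty}) q (fun x => Metric.thickening s (φ x))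
    (fun n => lowerHemicontinuous_iff_isOpen_inter_nonempty.1 hφ _ Metric.isOpen_ball)
    (fun x => by
      obtain ⟨y, hy⟩ := hne x
      obtain ⟨n, hn⟩ := hq.exists_dist_lt y hs
      exact ⟨n, y, hy, hn⟩)
    (fun x => (hconv x).thickening s)
    (fun n x ⟨y, hy, hyn⟩ => Metric.mem_thickening_iff.2 ⟨y, hy, by rwa [dist_comm]⟩)
  refine ⟨f, hf, fun x => ?_⟩
  obtain ⟨y, hy, hyn⟩ := Metric.mem_thickening_iff.1 (hft x)
  exact ⟨y, hy, by rwa [Metric.mem_ball, dist_comm]⟩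

open Set Filter Topology in
/-- Michael's selection theorem for countably paracompact normal spaces and separable Banach
spaces. -/
theorem LowerHemicontinuous.exists_continuous_mem_closure
    {X : Type u} [TopologicalSpace X] [NormalSpace X] (hX : CountablyParacompactSpace X)
    {E : Type v} [NormedAddCommGroup E] [NormedSpace ℝ E] [CompleteSpace E]
    [TopologicalSpace.SeparableSpace E]
    {φ : X → Set E} (hφ : LowerHemicontinuous φ) (hne : ∀ x, (φ x).Nonempty)
    (hconv : ∀ x, Convex ℝ (φ x)) :
    ∃ f : X → E, Continuous f ∧ ∀ x, f x ∈ closure (φ x) := by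
  let r : ℕ → ℝ := fun n => (1 / 2) ^ n
  have hr : ∀ n, 0 < r n := fun n => by positivity
  let S : ℕ → Type (max u v) := fun n =>
    {f : X → E // Continuous f ∧ ∀ x, (φ x ∩ Metric.ball (f x) (r n)).Nonempty}
  have step : ∀ n (f : S n), ∃ f' : S (n + 1), ∀ x, dist (f.1 x) (f'.1 x) ≤ 2 * (1 / 2) ^ n := by
    rintro n ⟨f, hf, hfφ⟩
    -- Approximating within the ball about `f` keeps the new map near the old one: they differ by
    -- less than `r n + r (n + 1)`, which is summable.
    obtain ⟨f', hf', hfφ'⟩ :=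
      (hφ.inter_ball hf (continuous_const (y := r n))).exists_continuous_inter_ball_nonempty hX hfφ
        (fun x => (hconv x).inter (convex_ball _ _)) (hr (n + 1))
    refine ⟨⟨f', hf', fun x => (hfφ' x).mono (by gcongr; exact inter_subset_left)⟩, fun x => ?_⟩
    obtain ⟨y, ⟨-, hy⟩, hy'⟩ := hfφ' x
    have h1 : dist y (f x) < (1 / 2) ^ n := hy
    have h2 : dist y (f' x) < (1 / 2) ^ (n + 1) := hy'
    have h3 := dist_triangle_left (f x) (f' x) y
    have h4 : (0 : ℝ) < (1 / 2) ^ n := hr n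
    rw [pow_succ] at h2
    change dist (f x) (f' x) ≤ _
    linarith
  choose next hnext using step
  obtain ⟨f₀, hf₀, hf₀φ⟩ := hφ.exists_continuous_inter_ball_nonempty hX hne hconv (hr 0)
  let F : ∀ n, S n := fun n => Nat.rec (motive := S) ⟨f₀, hf₀, hf₀φ⟩ next n
  have hF : ∀ x n, dist ((F n).1 x) ((F (n + 1)).1 x) ≤ 2 * (1 / 2) ^ n :=
    fun x n => hnext n (F n) x
  choose f hf using fun x =>
    cauchySeq_tendsto_of_complete (cauchySeq_of_le_geometric (1 / 2) 2 (by norm_num) (hF x))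
  have hdist : ∀ n x, dist ((F n).1 x) (f x) ≤ 4 * (1 / 2) ^ n := fun n x => by
    have := dist_le_of_le_geometric_of_tendsto (1 / 2) 2 (by norm_num) (hF x) (hf x) n
    exact this.trans_eq (by ring)
  have hsmall : ∀ ε > 0, ∀ᶠ n : ℕ in atTop, 4 * (1 / 2 : ℝ) ^ n < ε := fun ε hε => by
    have := (tendsto_pow_atTop_nhds_zero_of_lt_one (r := (1 / 2 : ℝ)) (by norm_num)
      (by norm_num)).const_mul 4
    rw [mul_zero] at this
    exact this.eventually_lt_const hε
  refine ⟨f, ?_, fun x => Metric.mem_closure_iff.2 fun ε hε => ?_⟩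
  · refine TendstoUniformly.continuous (F := fun n => (F n).1) (p := atTop) ?_
      (Frequently.of_forall fun n => (F n).2.1)
    refine Metric.tendstoUniformly_iff.2 fun ε hε => (hsmall ε hε).mono fun n hn x => ?_
    rw [dist_comm]
    exact (hdist n x).trans_lt hn
  · obtain ⟨n, hn⟩ := (hsmall (ε / 2) (by positivity)).exists
    obtain ⟨y, hy, hyn⟩ := (F n).2.2 x
    refine ⟨y, hy, ?_⟩
    have h1 : dist y ((F n).1 x) < (1 / 2) ^ n := hyn
    have h2 := dist_triangle_left (f x) y ((F n).1 x)
    have h3 : (0 : ℝ) < (1 / 2) ^ n := hr n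
    rw [dist_comm] at h1
    have := hdist n x
    linarith

/-- Continuous approximate selections can be improved to selections, with the same strict bound on
the distance. -/
theorem LowerHemicontinuous.exists_continuous_selection_dist_lt
    {X : Type u} [TopologicalSpace X] [NormalSpace X] (hX : CountablyParacompactSpace X)
    {E : Type v} [NormedAddCommGroup E] [NormedSpace ℝ E] [CompleteSpace E]
    [TopologicalSpace.SeparableSpace E] {φ : X → Set E} {η : X → ℝ} {g : X → E}
    (hne : ∀ x, (φ x).Nonempty) (hcl : ∀ x, IsClosed (φ x)) (hconv : ∀ x, Convex ℝ (φ x))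
    (hφ : LowerHemicontinuous φ) (hη : LowerSemicontinuous η) (hg : Continuous g)
    (hgφ : IsApproxSelection φ η g) :
    ∃ f : X → E, Continuous f ∧ IsSelection φ f ∧ ∀ x, dist (f x) (g x) < η x := by
  obtain ⟨α, hα, hαlt⟩ := exists_continuous_between_of_semicontinuous hX
    (hφ.upperSemicontinuous_infDist hne hg) hη hgφ
  obtain ⟨f, hf, hfφ⟩ := (hφ.inter_ball hg hα).exists_continuous_mem_closure hX
    (fun x => by
      obtain ⟨y, hy, hyx⟩ := (Metric.infDist_lt_iff (hne x)).1 (hαlt x).1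
      exact ⟨y, hy, by rwa [Metric.mem_ball, dist_comm]⟩)
    (fun x => (hconv x).inter (convex_ball _ _))
  refine ⟨f, hf, fun x => ?_, fun x => ?_⟩
  · exact (hcl x).closure_subset_iff.2 Set.inter_subset_left (hfφ x)
  · exact lt_of_le_of_lt (Metric.mem_closedBall.1 (Metric.closure_ball_subset_closedBall
      (closure_mono Set.inter_subset_right (hfφ x)))) (hαlt x).2

/-- The selection property for compact convex subsets of the line, with constant bounds. -/
def HasIntervalSelections (X : Type u) [TopologicalSpace X] : Prop :=
  ∀ (φ : X → Set ℝ) (ε : ℝ) (g : X → ℝ),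
    (∀ x, (φ x).Nonempty) → (∀ x, IsCompact (φ x)) → (∀ x, Convex ℝ (φ x)) →
    LowerHemicontinuous φ →
    0 < ε →
    Continuous g → IsApproxSelection φ (fun _ => ε) g →
    ∃ f : X → ℝ, Continuous f ∧ IsSelection φ f ∧ ∀ x, dist (f x) (g x) < ε

-- A selection with value 0 on `A`, 1 on `B` and values in `[0, 1]` elsewhere is a Urysohn function.
-- Lower hemicontinuity holds because 0 stays a value off `B`, and 1 off `A`.
open Set Filter Topology in
theorem HasIntervalSelections.normalSpace {X : Type u} [TopologicalSpace X]
    (h : HasIntervalSelections X) : NormalSpace X := by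
  classical
  refine ⟨fun A B hA hB hAB => ?_⟩
  let φ : X → Set ℝ := fun x => if x ∈ A then {0} else if x ∈ B then {1} else Icc 0 1
  have hφA : ∀ x ∈ A, φ x = {0} := fun x hx => if_pos hx
  have hφB : ∀ x ∈ B, φ x = {1} := fun x hx =>
    (if_neg (hAB.notMem_of_mem_right hx)).trans (if_pos hx)
  have hφ : ∀ x, x ∉ A → x ∉ B → φ x = Icc 0 1 := fun x h1 h2 => (if_neg h1).trans (if_neg h2)
  have cases : ∀ x, φ x = {0} ∨ φ x = {1} ∨ φ x = Icc 0 1 := fun x => by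
    by_cases h1 : x ∈ A
    · exact .inl (hφA x h1)
    by_cases h2 : x ∈ B
    · exact .inr (.inl (hφB x h2))
    exact .inr (.inr (hφ x h1 h2))
  have hne : ∀ x, (φ x).Nonempty := fun x => by rcases cases x with h | h | h <;> simp [h]
  have hzero : ∀ x ∉ B, (0 : ℝ) ∈ φ x := fun x hx => by
    by_cases h1 : x ∈ A
    · simp [hφA x h1]
    · simp [hφ x h1 hx]
  have hone : ∀ x ∉ A, (1 : ℝ) ∈ φ x := fun x hx => by
    by_cases h1 : x ∈ B
    · simp [hφB x h1]
    · simp [hφ x hx h1]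
  have hsub : ∀ x, φ x ⊆ Icc 0 1 := fun x => by rcases cases x with h | h | h <;> simp [h]
  -- All values lie within 1 of the zero map, so the bound 2 imposes nothing.
  obtain ⟨f, hf, hfφ, -⟩ := h φ 2 (fun _ => 0) hne
    (fun x => by
      rcases cases x with h | h | h <;> rw [h]
      exacts [isCompact_singleton, isCompact_singleton, isCompact_Icc])
    (fun x => by
      rcases cases x with h | h | h <;> rw [h]
      exacts [convex_singleton _, convex_singleton _, convex_Icc _ _])
    (fun x => lowerHemicontinuousAt_iff.2 fun u _ ⟨y, hy, hyu⟩ => by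
      by_cases h1 : x ∈ A
      · rw [hφA x h1, mem_singleton_iff] at hy
        filter_upwards [hB.isOpen_compl.mem_nhds (hAB.notMem_of_mem_left h1)] with x' hx'
        exact ⟨y, hy ▸ hzero x' hx', hyu⟩
      by_cases h2 : x ∈ B
      · rw [hφB x h2, mem_singleton_iff] at hy
        filter_upwards [hA.isOpen_compl.mem_nhds h1] with x' hx'
        exact ⟨y, hy ▸ hone x' hx', hyu⟩
      filter_upwards [hA.isOpen_compl.mem_nhds h1, hB.isOpen_compl.mem_nhds h2] with x' h1' h2'
      exact ⟨y, by rwa [hφ x' h1' h2', ← hφ x h1 h2], hyu⟩)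
    two_pos continuous_const
    (fun x => by
      obtain ⟨y, hy⟩ := hne x
      refine (Metric.infDist_le_dist_of_mem hy).trans_lt ?_
      have := hsub x hy
      rw [Real.dist_eq, abs_lt]
      constructor <;> linarith [this.1, this.2])
  refine ⟨f ⁻¹' Iio (1 / 2), f ⁻¹' Ioi (1 / 2), isOpen_Iio.preimage hf, isOpen_Ioi.preimage hf,
    fun x hx => ?_, fun x hx => ?_, ?_⟩
  · have := hfφ x
    rw [hφA x hx, mem_singleton_iff] at this
    simp [this]
  · have := hfφ x
    rw [hφB x hx, mem_singleton_iff] at this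
    simp only [mem_preimage, this, mem_Ioi]
    norm_num
  · exact Disjoint.preimage f (by simp)

-- Let `N x` be the first index of a cover set containing `x`. A selection of `[0, 1 / (N x + 1)]`
-- at distance less than 1 from the constant 1 is positive, so its reciprocal is a continuous
-- function dominating `N + 1`. Its level bands supply the local finiteness.
open Set Filter Topology in
theorem HasIntervalSelections.countablyParacompactSpace {X : Type u} [TopologicalSpace X]
    (h : HasIntervalSelections X) : CountablyParacompactSpace X := by
  classical
  refine ⟨fun s hs hcov => ?_⟩
  have hcov' : ∀ x, ∃ n, x ∈ s n := iUnion_eq_univ_iff.1 hcov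
  let N : X → ℕ := fun x => Nat.find (hcov' x)
  have hN : ∀ x, x ∈ s (N x) := fun x => Nat.find_spec (hcov' x)
  have hNle : ∀ x, ∀ᶠ x' in 𝓝 x, N x' ≤ N x := fun x => by
    filter_upwards [(hs _).mem_nhds (hN x)] with x' hx'
    exact Nat.find_min' _ hx'
  let k : X → ℝ := fun x => 1 / ((N x : ℝ) + 1)
  have hk : ∀ x, 0 < k x := fun x => by positivity
  have hk1 : ∀ x, k x ≤ 1 := fun x => (div_le_one₀ (by positivity)).2 (by simp)
  obtain ⟨f, hf, hfφ, hfg⟩ := h (fun x => Icc 0 (k x)) 1 (fun _ => 1)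
    (fun x => nonempty_Icc.2 (hk x).le) (fun x => isCompact_Icc) (fun x => convex_Icc _ _)
    (fun x => lowerHemicontinuousAt_iff.2 fun u _ ⟨y, hy, hyu⟩ => by
      filter_upwards [hNle x] with x' hx'
      exact ⟨y, ⟨hy.1, hy.2.trans (Nat.one_div_le_one_div hx')⟩, hyu⟩)
    one_pos continuous_const
    (fun x => by
      refine (Metric.infDist_le_dist_of_mem (right_mem_Icc.2 (hk x).le)).trans_lt ?_
      rw [Real.dist_eq, abs_lt]
      constructor <;> linarith [hk x, hk1 x])
  have hpos : ∀ x, 0 < f x := fun x => by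
    have := (abs_lt.1 (Real.dist_eq _ _ ▸ hfg x)).1
    linarith
  let p : X → ℝ := fun x => (f x)⁻¹
  have hp : Continuous p := hf.inv₀ fun x => (hpos x).ne'
  have hpp : ∀ x, 0 < p x := fun x => inv_pos.2 (hpos x)
  have hNp : ∀ x, (N x : ℝ) + 1 ≤ p x := fun x => by
    refine (le_inv_comm₀ (by positivity) (hpos x)).2 ?_
    rw [← one_div]
    exact (hfφ x).2
  -- Length 2 makes the bands overlap and cover all positive values of `p`.
  let V : ℕ → Set X := fun n => p ⁻¹' Ioo n (n + 2)
  have hV : ∀ n, IsOpen (V n) := fun n => isOpen_Ioo.preimage hp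
  -- On band `n` only the sets `s j` with `j ≤ n` are kept. They suffice: taking `n = ⌈p x⌉₊ - 1`
  -- gives `N x + 1 ≤ p x ≤ n + 1`.
  let t : ULift.{u} (ℕ × ℕ) → Set X := fun b => if b.down.2 ≤ b.down.1 then
    V b.down.1 ∩ s b.down.2 else ∅
  refine ⟨ULift.{u} (ℕ × ℕ), t, fun b => ?_, iUnion_eq_univ_iff.2 fun x => ?_, fun x => ?_,
    fun b => ⟨b.down.2, ?_⟩⟩
  · dsimp only [t]
    split_ifs
    exacts [(hV _).inter (hs _), isOpen_empty]
  · obtain ⟨n, hn⟩ : ∃ n, ⌈p x⌉₊ = n + 1 :=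
      Nat.exists_eq_succ_of_ne_zero (Nat.ceil_pos.2 (hpp x)).ne'
    have h1 : p x ≤ n + 1 := by
      have := Nat.le_ceil (p x)
      rw [hn] at this
      exact_mod_cast this
    have h2 : (n : ℝ) < p x := Nat.lt_ceil.1 (by omega)
    have h3 : N x ≤ n := by
      have : (N x : ℝ) ≤ n := by linarith [hNp x]
      exact_mod_cast this
    refine ⟨⟨(n, N x)⟩, ?_⟩
    simp only [t, if_pos h3]
    exact ⟨⟨h2, by linarith⟩, hN x⟩
  · obtain ⟨M, hM⟩ := exists_nat_gt (p x)
    refine ⟨p ⁻¹' Iio M, (isOpen_Iio.preimage hp).mem_nhds hM, ?_⟩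
    refine (((finite_Iic M).prod (finite_Iic M)).preimage ULift.down_injective.injOn).subset ?_
    rintro ⟨n, j⟩ ⟨y, hy, hyM⟩
    simp only [t] at hy
    split_ifs at hy with hjn
    · have : n < M := by
        have : (n : ℝ) < M := hy.1.1.trans hyM
        exact_mod_cast this
      exact ⟨this.le, hjn.trans this.le⟩
    · exact hy.elim
  · dsimp only [t]
    split_ifs
    exacts [inter_subset_right, empty_subset _]

theorem theorem4p1 (X : Type u) [TopologicalSpace X] [T1Space X] :
    List.TFAE [
      CountablyParacompactSpace X ∧ NormalSpace X,
      ∀ (E : Type v) [NormedAddCommGroup E] [NormedSpace ℝ E] [CompleteSpace E]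
        [TopologicalSpace.SeparableSpace E]
        (φ : X → Set E) (η : X → ℝ) (g : X → E),
        (∀ x, (φ x).Nonempty) → (∀ x, IsClosed (φ x)) → (∀ x, Convex ℝ (φ x)) →
        LowerHemicontinuous φ →
        (∀ x, 0 < η x) → LowerSemicontinuous η →
        Continuous g → IsApproxSelection φ η g →
        ∃ f : X → E, Continuous f ∧ IsSelection φ f ∧ ∀ x, dist (f x) (g x) < η x,
      ∀ (φ : X → Set ℝ) (ε : ℝ) (g : X → ℝ),
        (∀ x, (φ x).Nonempty) → (∀ x, IsCompact (φ x)) → (∀ x, Convex ℝ (φ x)) →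
        LowerHemicontinuous φ →
        0 < ε →
        Continuous g → IsApproxSelection φ (fun _ => ε) g →
        ∃ f : X → ℝ, Continuous f ∧ IsSelection φ f ∧ ∀ x, dist (f x) (g x) < ε] := by
  tfae_have 1 → 2 := by
    rintro ⟨hX, hN⟩ E _ _ _ _ φ η g hne hcl hconv hφ - hη hg hgφ
    exact hφ.exists_continuous_selection_dist_lt hX hne hcl hconv hη hg hgφ
  tfae_have 2 → 3 := by
    intro h φ ε g hne hcpt hconv hφ hε hg hgφ
    -- The line is lifted because `E` ranges over universe `v`.
    have : TopologicalSpace.SeparableSpace (ULift.{v} ℝ) :=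
      Homeomorph.ulift.symm.surjective.denseRange.separableSpace Homeomorph.ulift.symm.continuous
    obtain ⟨f, hf, hfφ, hfg⟩ := h (ULift.{v} ℝ) (fun x => ULift.down ⁻¹' φ x) (fun _ => ε)
      (fun x => ⟨g x⟩) (fun x => (hne x).preimage ULift.down_surjective)
      (fun x => (hcpt x).isClosed.preimage continuous_uliftDown)
      (fun x y hy z hz a b ha hb hab => hconv x hy hz ha hb hab)
      (fun x => lowerHemicontinuousAt_iff.2 fun u hu ⟨y, hy, hyu⟩ => by
        filter_upwards [lowerHemicontinuousAt_iff.1 (hφ x) _ (hu.preimage continuous_uliftUp)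
          ⟨y.down, hy, hyu⟩] with x' ⟨z, hz, hzu⟩
        exact ⟨⟨z⟩, hz, hzu⟩)
      (fun _ => hε) lowerSemicontinuous_const (continuous_uliftUp.comp hg)
      (fun x => by
        obtain ⟨y, hy, hyx⟩ := (Metric.infDist_lt_iff (hne x)).1 (hgφ x)
        exact (Metric.infDist_lt_iff ((hne x).preimage ULift.down_surjective)).2 ⟨⟨y⟩, hy, hyx⟩)
    exact ⟨fun x => (f x).down, continuous_uliftDown.comp hf, hfφ, hfg⟩
  tfae_have 3 → 1 := fun h =>
    ⟨HasIntervalSelections.countablyParacompactSpace h, HasIntervalSelections.normalSpace h⟩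
  tfae_finish
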